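/- Let $\mathcal T_1$ denote the class of functions $\psi\colon(-\infty,0)\to(-\infty,0]$ of class $C^\infty$ whose derivative is absolutely monotone, i.e. $\psi^{(k)}(s)\ge 0$ for all $k\ge 1$ and $s<0$. Let $f\colon(0,\infty)\to[0,\infty)$ be nondecreasing and such that its Laplace transform $\int_0^\infty e^{-pr}f(r)\,dr$ converges for every $p>0$, and let $w\colon(-\infty,0)\to\mathbb R$ be the function with $$w(-p)=\int_0^\infty e^{-pr}f(r)\,dr,\qquad p>0.$$ Let $\psi\in\mathcal T_1$ with $\psi'(-\infty):=\lim_{s\to-\infty}\psi'(s)=0$, and suppose that the integral $$\varphi(s)=\int_s^0\psi(t)\,w(t)\,dt$$ exists for every $s<0$. Then $\varphi\in\mathcal T_1$. -/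

import Mathlib

open Set Filter Topology MeasureTheory
open scoped ContDiff

/-- The class `𝒯₁` of negative Bernstein functions of one variable: the nonpositive functions in
`C^∞((-∞, 0))` whose first derivative is absolutely monotone on `(-∞, 0)`. Only the values of `ψ`
on `(-∞, 0)` matter. -/
structure NegBernstein (ψ : ℝ → ℝ) : Prop where
  contDiffOn : ContDiffOn ℝ ∞ ψ (Iio 0)
  nonpos : ∀ s < 0, ψ s ≤ 0
  absolutelyMonotoneOn_deriv : AbsolutelyMonotoneOn (deriv ψ) (Iio 0)

/-- `F` is the Laplace transform of `f`: for every `p > 0` the integral `∫₀^∞ e^{-pr} f(r) dr`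
converges and equals `F p`. Only the values of `f` and of `F` on `(0, ∞)` matter. -/
def IsLaplaceTransform (f F : ℝ → ℝ) : Prop :=
  ∀ p > 0, IntegrableOn (fun r => Real.exp (-(p * r)) * f r) (Ioi 0) ∧
    F p = ∫ r in Ioi 0, Real.exp (-(p * r)) * f r

open ProbabilityTheory

/-! On the negative axis `φ' = -ψ w = (ψ(s)/s) · (-s w(s))`, and absolutely monotone functions are
closed under products, so it suffices to treat each factor. For `ψ(s)/s`, the derivatives are
nonpositive multiples of the Taylor polynomials of `ψ` about `s` evaluated at `0`, which are
nonpositive. For `-s w(s)`, monotonicity of `f` is tested against kernels of zero mean with a single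
sign change. The sign of `φ` then follows from `-ψ w ≥ 0`. -/

theorem AbsolutelyMonotoneOn.iff_iteratedDeriv_nonneg {f : ℝ → ℝ} {s : Set ℝ} (hs : IsOpen s) :
    AbsolutelyMonotoneOn f s ↔ ContDiffOn ℝ ∞ f s ∧ ∀ n : ℕ, ∀ x ∈ s, 0 ≤ iteratedDeriv n f x := by
  rw [AbsolutelyMonotoneOn.iff_iteratedDerivWithin_nonneg hs.uniqueDiffOn]
  refine and_congr_right fun _ => forall_congr' fun n => forall₂_congr fun x hx => ?_
  rw [iteratedDerivWithin_of_isOpen hs hx]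

theorem AbsolutelyMonotoneOn.mul {f g : ℝ → ℝ} {s : Set ℝ} (hs : UniqueDiffOn ℝ s)
    (hf : AbsolutelyMonotoneOn f s) (hg : AbsolutelyMonotoneOn g s) :
    AbsolutelyMonotoneOn (f * g) s := by
  refine (AbsolutelyMonotoneOn.iff_iteratedDerivWithin_nonneg hs).2
    ⟨hf.contDiffOn.mul hg.contDiffOn, fun n x hx => ?_⟩
  have hn : (n : WithTop ℕ∞) ≤ ∞ := mod_cast le_top
  rw [iteratedDerivWithin_mul hx hs ((hf.contDiffOn x hx).of_le hn)
    ((hg.contDiffOn x hx).of_le hn)]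
  exact Finset.sum_nonneg fun i _ => mul_nonneg
    (mul_nonneg (Nat.cast_nonneg _) (hf.iteratedDerivWithin_nonneg hs i hx))
    (hg.iteratedDerivWithin_nonneg hs _ hx)

theorem AbsolutelyMonotoneOn.congr {f g : ℝ → ℝ} {s : Set ℝ} (hf : AbsolutelyMonotoneOn f s)
    (h : EqOn g f s) : AbsolutelyMonotoneOn g s := by
  obtain ⟨p, hp, hp_nn⟩ := hf
  exact ⟨p, hp.congr h, hp_nn⟩

namespace NegBernstein

variable {ψ : ℝ → ℝ}

theorem iteratedDeriv_succ_nonneg (hψ : NegBernstein ψ) (n : ℕ) {s : ℝ} (hs : s < 0) :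
    0 ≤ iteratedDeriv (n + 1) ψ s := by
  rw [iteratedDeriv_succ']
  exact ((AbsolutelyMonotoneOn.iff_iteratedDeriv_nonneg isOpen_Iio).1
    hψ.absolutelyMonotoneOn_deriv).2 n s hs

/-- The Taylor polynomials of a negative Bernstein function, extrapolated to the endpoint `0`,
are nonpositive. -/
theorem sum_taylor_nonpos (hψ : NegBernstein ψ) (n : ℕ) {s : ℝ} (hs : s < 0) :
    ∑ k ∈ Finset.range (n + 1), ((k.factorial : ℝ)⁻¹ * (-s) ^ k) * iteratedDeriv k ψ s ≤ 0 := by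
  set T : ℝ → ℝ := fun x =>
    ∑ k ∈ Finset.range (n + 1), ((k.factorial : ℝ)⁻¹ * (x - s) ^ k) * iteratedDeriv k ψ s with hT
  -- `ψ` need not extend smoothly to `0`, so Taylor's formula is used at `x < 0`: `T x` is `ψ x ≤ 0`
  -- minus a nonnegative Lagrange remainder. Then `x → 0⁻`.
  have hle : ∀ x ∈ Ioo s 0, T x ≤ 0 := by
    intro x hx
    have hsub : uIcc s x ⊆ Iio 0 := by
      rw [uIcc_of_le hx.1.le]
      exact fun y hy => hy.2.trans_lt hx.2
    have hcd : ContDiffOn ℝ (n + 1) ψ (uIcc s x) :=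
      (hψ.contDiffOn.mono hsub).of_le (mod_cast le_top)
    obtain ⟨y, hy, hyx⟩ := taylor_mean_remainder_lagrange_iteratedDeriv hx.1.ne hcd
    have hTx : taylorWithinEval ψ n (uIcc s x) s x = T x := by
      rw [taylor_within_apply, hT]
      refine Finset.sum_congr rfl fun k _ => ?_
      rw [smul_eq_mul, iteratedDerivWithin_eq_iteratedDeriv (uniqueDiffOn_uIcc hx.1.ne)
        ((hψ.contDiffOn.contDiffAt (Iio_mem_nhds hs)).of_le (mod_cast le_top)) left_mem_uIcc]
    have hy0 : y < 0 := hsub ⟨hy.1.le, hy.2.le⟩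
    have hrem : 0 ≤ iteratedDeriv (n + 1) ψ y * (x - s) ^ (n + 1) / (n + 1).factorial := by
      have := hψ.iteratedDeriv_succ_nonneg n hy0
      have := sub_nonneg.2 hx.1.le
      positivity
    rw [hTx] at hyx
    linarith [hψ.nonpos x hx.2]
  have hcont : Continuous T := by fun_prop
  have h0 : T 0 ≤ 0 := le_of_tendsto ((hcont.tendsto 0).mono_left nhdsWithin_le_nhds)
    (mem_of_superset (Ioo_mem_nhdsLT hs) hle)
  simpa [hT] using h0

theorem absolutelyMonotoneOn_mul_inv (hψ : NegBernstein ψ) :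
    AbsolutelyMonotoneOn (ψ * fun s => s⁻¹) (Iio 0) := by
  have hinv : ContDiffOn ℝ ∞ (fun s : ℝ => s⁻¹) (Iio 0) :=
    contDiffOn_id.inv fun s hs => ne_of_lt hs
  refine (AbsolutelyMonotoneOn.iff_iteratedDeriv_nonneg isOpen_Iio).2
    ⟨hψ.contDiffOn.mul hinv, fun n s hs => ?_⟩
  have hn : (n : WithTop ℕ∞) ≤ ∞ := mod_cast le_top
  have hs0 : 0 < -s := neg_pos.2 hs
  rw [iteratedDeriv_mul ((hψ.contDiffOn.contDiffAt (Iio_mem_nhds hs)).of_le hn)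
    ((hinv.contDiffAt (Iio_mem_nhds hs)).of_le hn)]
  -- The factor `-n! (-s)^(-(n+1))` is common to all Leibniz terms; what remains is the Taylor sum
  -- at `0`.
  have hterm : ∀ k ∈ Finset.range (n + 1),
      (n.choose k : ℝ) * iteratedDeriv k ψ s * iteratedDeriv (n - k) (fun s : ℝ => s⁻¹) s =
        -((n.factorial : ℝ) * ((-s) ^ (n + 1))⁻¹) *
          (((k.factorial : ℝ)⁻¹ * (-s) ^ k) * iteratedDeriv k ψ s) := by
    intro k hk
    have hkn : k ≤ n := Nat.lt_succ_iff.1 (Finset.mem_range.1 hk)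
    have hpow : (-1 : ℝ) ^ (n - k) * s ^ (-1 - ((n - k : ℕ) : ℤ)) =
        -(((-s) ^ (n + 1))⁻¹ * (-s) ^ k) := by
      have h1 : s ^ (-1 - ((n - k : ℕ) : ℤ)) = (s ^ (n - k + 1))⁻¹ := by
        rw [← zpow_natCast, ← zpow_neg]
        congr 1
        push_cast
        ring
      have h2 : (-s) ^ (n + 1) = (-s) ^ (n - k + 1) * (-s) ^ k := by
        rw [← pow_add]
        congr 1
        omega
      have h3 : (-s) ^ (n - k + 1) = -((-1) ^ (n - k) * s ^ (n - k + 1)) := by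
        rw [neg_pow, pow_succ (-1 : ℝ)]
        ring
      have hsne : s ≠ 0 := ne_of_lt hs
      have h4 : ((-1 : ℝ) ^ (n - k)) ^ 2 = 1 := by
        rw [← pow_mul, mul_comm, pow_mul]
        norm_num
      rw [h1, h2, mul_inv, mul_assoc, inv_mul_cancel₀ (pow_ne_zero _ hs0.ne'), mul_one, h3]
      field_simp
      exact h4
    have hchoose : (n.choose k : ℝ) * ((n - k).factorial : ℝ) =
        (n.factorial : ℝ) * (k.factorial : ℝ)⁻¹ := by
      rw [← Nat.choose_mul_factorial_mul_factorial hkn]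
      push_cast
      field_simp
    rw [iteratedDeriv_eq_iterate, iteratedDeriv_eq_iterate, iter_deriv_inv]
    calc _ = ((n.choose k : ℝ) * ((n - k).factorial : ℝ)) *
          ((-1 : ℝ) ^ (n - k) * s ^ (-1 - ((n - k : ℕ) : ℤ))) * deriv^[k] ψ s := by ring
      _ = _ := by rw [hchoose, hpow]; ring
  rw [Finset.sum_congr rfl hterm, ← Finset.mul_sum]
  exact mul_nonneg_of_nonpos_of_nonpos (neg_nonpos.2 (by positivity)) (hψ.sum_taylor_nonpos n hs)

end NegBernstein

theorem integrableOn_pow_mul_exp_mul_Ioi (n : ℕ) {s : ℝ} (hs : s < 0) :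
    IntegrableOn (fun r => r ^ n * Real.exp (s * r)) (Ioi 0) := by
  have hsub : Iio 0 ⊆ integrableExpSet id (volume.restrict (Ioi (0 : ℝ))) := fun t ht => by
    exact integrableOn_exp_mul_Ioi ht 0
  exact integrable_pow_mul_exp_of_mem_interior_integrableExpSet
    (interior_maximal hsub isOpen_Iio hs) n

theorem integral_pow_mul_exp_mul_Ioi (n : ℕ) {s : ℝ} (hs : s < 0) :
    ∫ r in Ioi 0, r ^ n * Real.exp (s * r) = n.factorial * (-s)⁻¹ ^ (n + 1) := by
  have h := Real.integral_rpow_mul_exp_neg_mul_Ioi (a := n + 1) (by positivity) (neg_pos.2 hs)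
  rw [Real.Gamma_nat_eq_factorial] at h
  convert! h using 1
  · refine setIntegral_congr_fun measurableSet_Ioi fun r _ => ?_
    simp
  · rw [one_div, mul_comm]
    norm_cast

/-- A nondecreasing `f` integrates nonnegatively against minus the derivative of
`r ↦ r ^ (n + 1) * exp (s * r)`, a function which changes sign once, from minus to plus. -/
theorem MonotoneOn.integral_pow_mul_exp_mul_sub_nonneg {f : ℝ → ℝ} (hf : MonotoneOn f (Ioi 0))
    {s : ℝ} (hs : s < 0)
    (hint : ∀ n : ℕ, IntegrableOn (fun r => r ^ n * Real.exp (s * r) * f r) (Ioi 0)) (n : ℕ) :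
    0 ≤ -s * (∫ r in Ioi 0, r ^ (n + 1) * Real.exp (s * r) * f r) -
      (n + 1) * ∫ r in Ioi 0, r ^ n * Real.exp (s * r) * f r := by
  have hs0 : 0 < -s := neg_pos.2 hs
  -- The sign change: the kernel equals `-s * r ^ n * exp (s * r) * (r - c)`.
  set c : ℝ := (n + 1) / (-s) with hc
  have hc0 : 0 < c := by positivity
  have hcs : -s * c = n + 1 := mul_div_cancel₀ _ hs0.ne'
  have hE := integrableOn_pow_mul_exp_mul_Ioi (s := s) (hs := hs)
  -- The kernel has zero mean, so `f` may be replaced by `f r - f c`, which has the sign of `r - c`.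
  have hzero : ∫ r in Ioi 0, f c * (-s * (r ^ (n + 1) * Real.exp (s * r)) -
      (n + 1) * (r ^ n * Real.exp (s * r))) = 0 := by
    rw [integral_const_mul, integral_sub ((hE _).const_mul _) ((hE _).const_mul _),
      integral_const_mul, integral_const_mul, integral_pow_mul_exp_mul_Ioi _ hs,
      integral_pow_mul_exp_mul_Ioi _ hs, Nat.factorial_succ, pow_succ (-s)⁻¹ (n + 1)]
    have hcancel : -s * (-s)⁻¹ = 1 := mul_inv_cancel₀ hs0.ne'
    push_cast
    linear_combination (f c * ((n + 1) * n.factorial) * (-s)⁻¹ ^ (n + 1)) * hcancel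
  rw [← integral_const_mul, ← integral_const_mul,
    ← integral_sub ((hint _).const_mul _) ((hint _).const_mul _)]
  refine hzero.symm.le.trans ?_
  refine setIntegral_mono_on ?_ ?_ measurableSet_Ioi fun r hr => ?_
  · exact (((hE _).const_mul _).sub ((hE _).const_mul _)).const_mul _
  · exact ((hint _).const_mul _).sub ((hint _).const_mul _)
  · have hr0 : 0 < r := hr
    have hkey : 0 ≤ (r - c) * (f r - f c) := by
      rcases le_total r c with h | h
      · exact mul_nonneg_of_nonpos_of_nonpos (sub_nonpos.2 h) (sub_nonpos.2 (hf hr hc0 h))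
      · exact mul_nonneg (sub_nonneg.2 h) (sub_nonneg.2 (hf hc0 hr h))
    have hfac : 0 ≤ -s * (r ^ n * Real.exp (s * r)) * ((r - c) * (f r - f c)) := by positivity
    rw [← hcs]
    rw [← sub_nonneg]
    refine hfac.trans_eq ?_
    ring

/-- The measure `f(r) dr` on `(0, ∞)`. -/
noncomputable def densityIoi (f : ℝ → ℝ) : Measure ℝ :=
  (volume.restrict (Ioi 0)).withDensity fun r => ENNReal.ofReal (f r)

section densityIoi

variable {f : ℝ → ℝ}

theorem integral_densityIoi (hf : ∀ r > 0, 0 ≤ f r) (hf_mono : MonotoneOn f (Ioi 0)) (g : ℝ → ℝ) :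
    ∫ r, g r ∂densityIoi f = ∫ r in Ioi 0, g r * f r := by
  rw [densityIoi, integral_withDensity_eq_integral_toReal_smul₀
    (aemeasurable_restrict_of_monotoneOn measurableSet_Ioi hf_mono).ennreal_ofReal
    (Eventually.of_forall fun _ => ENNReal.ofReal_lt_top)]
  refine setIntegral_congr_fun measurableSet_Ioi fun r hr => ?_
  simp only [smul_eq_mul]
  rw [ENNReal.toReal_ofReal (hf r hr), mul_comm]

theorem integrable_densityIoi_iff (hf : ∀ r > 0, 0 ≤ f r) (hf_mono : MonotoneOn f (Ioi 0))
    {g : ℝ → ℝ} :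
    Integrable g (densityIoi f) ↔ IntegrableOn (fun r => g r * f r) (Ioi 0) := by
  rw [densityIoi, integrable_withDensity_iff_integrable_smul₀'
    (aemeasurable_restrict_of_monotoneOn measurableSet_Ioi hf_mono).ennreal_ofReal
    (Eventually.of_forall fun _ => ENNReal.ofReal_lt_top)]
  refine integrableOn_congr_fun (fun r hr => ?_) measurableSet_Ioi
  simp only [smul_eq_mul]
  rw [ENNReal.toReal_ofReal (hf r hr), mul_comm]

end densityIoi

namespace IsLaplaceTransform

variable {f w : ℝ → ℝ}

theorem eqOn_mgf (hf : ∀ r > 0, 0 ≤ f r) (hf_mono : MonotoneOn f (Ioi 0))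
    (hw : IsLaplaceTransform f (fun p => w (-p))) :
    EqOn w (mgf id (densityIoi f)) (Iio 0) := by
  intro s hs
  have h := (hw (-s) (neg_pos.2 hs)).2
  simp only [neg_neg, neg_mul] at h
  rw [h, mgf, integral_densityIoi hf hf_mono]
  rfl

theorem Iio_subset_interior_integrableExpSet (hf : ∀ r > 0, 0 ≤ f r)
    (hf_mono : MonotoneOn f (Ioi 0)) (hw : IsLaplaceTransform f (fun p => w (-p))) :
    Iio 0 ⊆ interior (integrableExpSet id (densityIoi f)) := by
  refine interior_maximal (fun s hs => ?_) isOpen_Iio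
  have h := (hw (-s) (neg_pos.2 hs)).1
  simp only [neg_neg, neg_mul] at h
  exact (integrable_densityIoi_iff hf hf_mono).2 h

/-- If `F` is the Laplace transform of a nonnegative nondecreasing function, then
`p ↦ p * F p` is completely monotone. -/
theorem absolutelyMonotoneOn_neg_mul (hf : ∀ r > 0, 0 ≤ f r) (hf_mono : MonotoneOn f (Ioi 0))
    (hw : IsLaplaceTransform f (fun p => w (-p))) :
    AbsolutelyMonotoneOn ((fun s => -s) * w) (Iio 0) := by
  have hint := hw.Iio_subset_interior_integrableExpSet hf hf_mono
  -- As a moment generating function, `w` is analytic and can be differentiated under the integral.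
  set M : ℝ → ℝ := mgf id (densityIoi f) with hM
  have hMcd : ContDiffOn ℝ ∞ M (Iio 0) := fun s hs =>
    (analyticAt_mgf (hint hs)).contDiffAt.contDiffWithinAt
  have hderiv : ∀ (n : ℕ) {s : ℝ}, s < 0 →
      iteratedDeriv n M s = ∫ r in Ioi 0, r ^ n * Real.exp (s * r) * f r := fun n s hs => by
    rw [hM, iteratedDeriv_mgf (hint hs), integral_densityIoi hf hf_mono]
    rfl
  suffices h : AbsolutelyMonotoneOn ((fun s => -s) * M) (Iio 0) from
    h.congr fun s hs => by simp [hw.eqOn_mgf hf hf_mono hs, hM]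
  have hneg : ContDiff ℝ ∞ (fun s : ℝ => -s) := contDiff_neg
  refine (AbsolutelyMonotoneOn.iff_iteratedDeriv_nonneg isOpen_Iio).2
    ⟨hneg.contDiffOn.mul hMcd, fun n s hs => ?_⟩
  have hs' : s < 0 := hs
  have hints : ∀ n : ℕ, IntegrableOn (fun r => r ^ n * Real.exp (s * r) * f r) (Ioi 0) := fun n =>
    (integrable_densityIoi_iff hf hf_mono).1
      (integrable_pow_mul_exp_of_mem_interior_integrableExpSet (hint hs) n)
  cases n with
  | zero =>
    rw [iteratedDeriv_zero, Pi.mul_apply, hM]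
    exact mul_nonneg (neg_pos.2 hs).le mgf_nonneg
  | succ n =>
    have hn : ((n + 1 : ℕ) : WithTop ℕ∞) ≤ ∞ := mod_cast le_top
    -- As `-s` is affine, only the two lowest Leibniz terms survive.
    rw [iteratedDeriv_mul (hneg.contDiffAt.of_le hn)
      ((hMcd.contDiffAt (Iio_mem_nhds hs)).of_le hn), Finset.sum_range_succ',
      Finset.sum_range_succ', Finset.sum_eq_zero]
    · have h := hf_mono.integral_pow_mul_exp_mul_sub_nonneg hs' hints n
      rw [← hderiv _ hs', ← hderiv _ hs'] at h
      simp
      linarith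
    · intro k _
      have : iteratedDeriv (k + 1 + 1) (fun s : ℝ => -s) s = 0 := by
        rw [iteratedDeriv_succ', iteratedDeriv_succ']
        simp
      rw [this]
      ring

end IsLaplaceTransform

theorem theorem4 (f w ψ : ℝ → ℝ)
    (hf_nonneg : ∀ r > 0, 0 ≤ f r)
    (hf_mono : MonotoneOn f (Ioi 0))
    (hw : IsLaplaceTransform f (fun p => w (-p)))
    (hψ : NegBernstein ψ)
    (hψ_deriv : Tendsto (deriv ψ) atBot (𝓝 0))
    (hint : ∀ s < 0, IntegrableOn (fun t => ψ t * w t) (Ioo s 0)) :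
    NegBernstein (fun s => ∫ t in s..0, ψ t * w t) := by
  have hAM : AbsolutelyMonotoneOn (fun s => -(ψ s * w s)) (Iio 0) :=
    (hψ.absolutelyMonotoneOn_mul_inv.mul isOpen_Iio.uniqueDiffOn
      (hw.absolutelyMonotoneOn_neg_mul hf_nonneg hf_mono)).congr fun s hs => by
        have hs0 : s ≠ 0 := ne_of_lt hs
        simp only [Pi.mul_apply]
        field_simp
  have hcont : ContinuousOn (fun s => ψ s * w s) (Iio 0) := by
    have h := hAM.contDiffOn.continuousOn.neg
    simp only [Pi.neg_def, neg_neg] at h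
    exact h
  have hderiv : ∀ s < 0,
      HasDerivAt (fun s => ∫ t in s..0, ψ t * w t) (-(ψ s * w s)) s := fun s hs =>
    intervalIntegral.integral_hasDerivAt_left
      ((intervalIntegrable_iff_integrableOn_Ioo_of_le hs.le).2 (hint s hs))
      (hcont.stronglyMeasurableAtFilter isOpen_Iio s hs) (hcont.continuousAt (Iio_mem_nhds hs))
  have hAM' : AbsolutelyMonotoneOn (deriv fun s => ∫ t in s..0, ψ t * w t) (Iio 0) :=
    hAM.congr fun s hs => (hderiv s hs).deriv
  refine ⟨?_, fun s hs => ?_, hAM'⟩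
  · exact (contDiffOn_infty_iff_deriv_of_isOpen isOpen_Iio).2
      ⟨fun s hs => (hderiv s hs).differentiableAt.differentiableWithinAt, hAM'.contDiffOn⟩
  · have hnn : 0 ≤ ∫ t in s..0, -(ψ t * w t) := by
      rw [intervalIntegral.integral_of_le hs.le, integral_Ioc_eq_integral_Ioo]
      exact setIntegral_nonneg measurableSet_Ioo fun t ht => by
        simpa using hAM.iteratedDerivWithin_nonneg isOpen_Iio.uniqueDiffOn 0 ht.2
    rw [intervalIntegral.integral_neg] at hnn
    linarith
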